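/- All graphs are finite and simple. For an integer $k\ge 2$, a multiset $\mathscr{P}$ of paths in a graph $G$ is a \emph{$k$-rainbow separating path system} if its elements can be colored with $k$ colors so that for every two distinct edges $e_1,e_2$ of $G$ there exist $P_1,P_2\in\mathscr{P}$ of distinct colors such that $P_1$ contains $e_1$ but not $e_2$, and $P_2$ contains $e_2$ but not $e_1$. Let $c_k(G)$ denote the smallest cardinality of a $k$-rainbow separating path system of $G$. A class $\Sigma$ of trees is \emph{pathy} if the number of vertices of degree at least $3$ of its members on $n$ vertices is $o(n)$, i.e. there is a function $b:\mathbb{N}\to\mathbb{R}$ with $b(n)=o(n)$ such that every $T\in\Sigma$ on $n$ vertices has at most $b(n)$ vertices of degree at least $3$. \textbf{Theorem.} (1) If $T$ is a tree on $n$ vertices that is not a path, then $c_k(T)\le n-1$ for every $k\ge 4$. (2) For pathy classes of trees this bound is tight up to a sublinear error: for every pathy class $\Sigma$ of trees there is a function $g:\mathbb{N}\to\mathbb{R}$ with $g(n)=o(n)$ such that $c_k(T)\ge n-1-g(n)$ for every $k\ge 4$ and every $T\in\Sigma$ on $n$ vertices. -/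

import Mathlib

open Filter Asymptotics

namespace RainbowSep

/-- A path of `G`: two end vertices and a walk between them without repeated vertices. A path and
its reversal have the same edges, so keeping both does not affect any notion below. -/
abbrev GraphPath {V : Type*} (G : SimpleGraph V) : Type _ :=
  Σ u v : V, G.Path u v

/-- The edge `e` lies on the path `P`. -/
def GraphPath.HasEdge {V : Type*} {G : SimpleGraph V} (P : GraphPath G) (e : Sym2 V) : Prop :=
  e ∈ P.2.2.1.edges

/-- A multiset `P` of paths of `G` is a `k`-rainbow separating path system: its members can be
coloured with `k` colours (`Q` is the coloured multiset; equal members may get different colours)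
so that any two distinct edges `e`, `f` lie on two members of distinct colours, one containing `e`
and not `f`, the other containing `f` and not `e`. -/
def IsRSPS {V : Type*} (G : SimpleGraph V) (k : ℕ) (P : Multiset (GraphPath G)) : Prop :=
  ∃ Q : Multiset (GraphPath G × Fin k), Q.map Prod.fst = P ∧
    ∀ e ∈ G.edgeSet, ∀ f ∈ G.edgeSet, e ≠ f →
      ∃ x ∈ Q, ∃ y ∈ Q, x.2 ≠ y.2 ∧
        (x.1.HasEdge e ∧ ¬ x.1.HasEdge f) ∧ (y.1.HasEdge f ∧ ¬ y.1.HasEdge e)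

/-- The `k`-rainbow separation number `c_k(G)`: the smallest cardinality of a `k`-rainbow
separating path system of `G`. -/
noncomputable def rainbowSepNumber {V : Type*} (G : SimpleGraph V) (k : ℕ) : ℕ :=
  sInf {m : ℕ | ∃ P : Multiset (GraphPath G), IsRSPS G k P ∧ P.card = m}

/-- For at least two colours the minimum in `rainbowSepNumber` is attained. -/
theorem exists_isRSPS_card_eq {V : Type*} [Finite V] (G : SimpleGraph V) {k : ℕ} (hk : 2 ≤ k) :
    ∃ P : Multiset (GraphPath G), IsRSPS G k P ∧ P.card = rainbowSepNumber G k := by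
  classical
  have key : ∀ e : G.edgeSet, ∃ P : GraphPath G, ∀ f : Sym2 V, P.HasEdge f ↔ f = e := by
    rintro ⟨e, he⟩
    induction e using Sym2.ind with
    | _ a b =>
      have hab : G.Adj a b := he
      refine ⟨⟨a, b, SimpleGraph.Path.singleton hab⟩, fun f => ?_⟩
      simp [GraphPath.HasEdge, SimpleGraph.Path.singleton]
  choose p hp using key
  have : Fintype G.edgeSet := Fintype.ofFinite _
  let Q : Multiset (GraphPath G × Fin k) :=
    (Finset.univ : Finset (G.edgeSet × Fin k)).val.map fun z => (p z.1, z.2)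
  have hne : {m : ℕ | ∃ P : Multiset (GraphPath G), IsRSPS G k P ∧ P.card = m}.Nonempty := by
    refine ⟨_, Q.map Prod.fst, ⟨Q, rfl, fun e he f hf hef => ?_⟩, rfl⟩
    refine ⟨(p ⟨e, he⟩, ⟨0, by omega⟩), ?_, (p ⟨f, hf⟩, ⟨1, by omega⟩), ?_, ?_, ?_, ?_⟩
    · exact Multiset.mem_map.2 ⟨(⟨e, he⟩, ⟨0, by omega⟩), by simp, rfl⟩
    · exact Multiset.mem_map.2 ⟨(⟨f, hf⟩, ⟨1, by omega⟩), by simp, rfl⟩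
    · simp
    · exact ⟨(hp _ _).2 rfl, fun h => hef ((hp _ _).1 h).symm⟩
    · exact ⟨(hp _ _).2 rfl, fun h => hef ((hp _ _).1 h)⟩
  exact Nat.sInf_mem hne

/-- The finite graph `G` is a path (on any number of vertices, one included). -/
def IsPathGraph {V : Type*} [Fintype V] (G : SimpleGraph V) : Prop :=
  Nonempty (G ≃g SimpleGraph.pathGraph (Fintype.card V))

open Classical in
/-- The number of vertices of degree at least `3`. -/
noncomputable def numBranchVertices {V : Type*} [Fintype V] (G : SimpleGraph V) : ℕ :=
  (Finset.univ.filter fun v : V => 3 ≤ G.degree v).card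

/-- A class of finite graphs, given as a family `T i`, is a pathy class of trees: every member is
a tree, and the members on `n` vertices have `o(n)` vertices of degree at least `3`. -/
def IsPathyTreeClass {ι : Type*} {V : ι → Type*} [∀ i, Fintype (V i)]
    (T : ∀ i, SimpleGraph (V i)) : Prop :=
  (∀ i, (T i).IsTree) ∧
    ∃ b : ℕ → ℝ, b =o[atTop] (fun n : ℕ => (n : ℝ)) ∧
      ∀ i, (numBranchVertices (T i) : ℝ) ≤ b (Fintype.card (V i))

end RainbowSep

/-!
Root the graph at `r` along a breadth-first search, so that every vertex `v ≠ r` stands for the edge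
to its parent; in a tree these are all the edges.

Upper bound: order the children of every vertex, those of the root cyclically, and let `φ v` be the
previous sibling of `v`, or its parent if `v` is a first child. For every `u ≠ r` the edge `u` and
the edges `v` with `φ v = u` form a path, with at most one of the latter at each end of `u`. The
edge `v` lies on the two paths `v` and `φ v` only. If the root has degree at least three, its cycle
of children can be coloured with four colours, and in breadth-first order every other path has to
avoid the colours of at most three earlier ones.

Lower bound: if an edge lies on a single path of a separating system, that path has no other edge.
Call such edges light. A vertex of degree at most two with an incident edge that is not light is an
end of at least two paths without light edges. Since a path has only two ends, there are at most as
many vertices of this kind as paths without light edges. Every other vertex `v ≠ r` of degree at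
most two can be charged to the path that contains the light edge `v`.
-/

namespace RainbowSep

section ParentMap

variable {V : Type*} {G : SimpleGraph V} {r : V}

/-- `p` is the parent map of a breadth-first search from `r`: it sends every other vertex to a
neighbour that is closer to `r`. The root is excluded from the domain, so that the domain
parametrizes the edges of a spanning tree. -/
structure IsParentMap (G : SimpleGraph V) (r : V) (p : {v // v ≠ r} → V) : Prop where
  adj (v : {v // v ≠ r}) : G.Adj v (p v)
  dist_eq (v : {v // v ≠ r}) : G.dist r v = G.dist r (p v) + 1

theorem exists_adj_dist_eq_add_one (hG : G.Connected) {v : V} (hv : v ≠ r) :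
    ∃ w, G.Adj v w ∧ G.dist r v = G.dist r w + 1 := by
  obtain ⟨q, hq⟩ := hG.exists_walk_length_eq_dist v r
  have hnil : ¬ q.Nil := SimpleGraph.Walk.not_nil_of_ne hv
  refine ⟨q.snd, q.adj_snd hnil, le_antisymm ?_ ?_⟩
  · rw [← SimpleGraph.dist_eq_one_iff_adj.2 (q.adj_snd hnil).symm]
    exact hG.dist_triangle
  · rw [SimpleGraph.dist_comm, SimpleGraph.dist_comm (v := v), ← hq,
      ← SimpleGraph.Walk.length_tail_add_one hnil]
    exact Nat.succ_le_succ (SimpleGraph.dist_le q.tail)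

theorem exists_isParentMap (hG : G.Connected) (r : V) : ∃ p, IsParentMap G r p := by
  choose p hadj hdist using fun v : {v // v ≠ r} => exists_adj_dist_eq_add_one hG v.2
  exact ⟨p, hadj, hdist⟩

/-- The edge joining `v` to its parent. -/
def parentEdge (p : {v // v ≠ r} → V) (v : {v // v ≠ r}) : Sym2 V := s(↑v, p v)

namespace IsParentMap

variable {p : {v // v ≠ r} → V}

theorem ne (hp : IsParentMap G r p) (v : {v // v ≠ r}) : p v ≠ v := (hp.adj v).ne'

theorem dist_eq_one (hp : IsParentMap G r p) {v : {v // v ≠ r}} (hv : p v = r) :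
    G.dist r v = 1 := by
  rw [hp.dist_eq, hv, SimpleGraph.dist_self]

theorem parentEdge_mem_edgeSet (hp : IsParentMap G r p) (v : {v // v ≠ r}) :
    parentEdge p v ∈ G.edgeSet :=
  hp.adj v

theorem parentEdge_injective (hp : IsParentMap G r p) : Function.Injective (parentEdge p) := by
  intro v w hvw
  rcases Sym2.eq_iff.1 hvw with ⟨h, -⟩ | ⟨hv, hw⟩
  · exact Subtype.ext h
  · have hdv := hp.dist_eq v
    have hdw := hp.dist_eq w
    rw [hw] at hdv
    rw [← hv] at hdw
    omega

theorem range_parentEdge [Finite V] (hp : IsParentMap G r p) (hG : G.IsTree) :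
    Set.range (parentEdge p) = G.edgeSet := by
  classical
  have := Fintype.ofFinite V
  refine Set.eq_of_subset_of_ncard_le (Set.range_subset_iff.2 hp.parentEdge_mem_edgeSet) ?_
  rw [Set.ncard_range_of_injective hp.parentEdge_injective, Nat.card_eq_fintype_card,
    Fintype.card_subtype_compl, Fintype.card_subtype_eq, ← hG.card_edgeFinset,
    ← SimpleGraph.coe_edgeFinset, Set.ncard_coe_finset, Nat.add_sub_cancel]

theorem edgeSet_nontrivial [Fintype V] (hp : IsParentMap G r p) (hV : 3 ≤ Fintype.card V) :
    G.edgeSet.Nontrivial := by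
  classical
  have : Nontrivial {v // v ≠ r} := by
    rw [← Fintype.one_lt_card_iff_nontrivial, Fintype.card_subtype_compl, Fintype.card_subtype_eq]
    omega
  obtain ⟨v, w, hvw⟩ := exists_pair_ne {v // v ≠ r}
  exact ⟨_, hp.parentEdge_mem_edgeSet v, _, hp.parentEdge_mem_edgeSet w,
    hp.parentEdge_injective.ne hvw⟩

theorem ncard_children_root (hp : IsParentMap G r p) (hG : G.Connected)
    [Fintype (G.neighborSet r)] : (p ⁻¹' {r}).ncard = G.degree r := by
  have himage : Subtype.val '' (p ⁻¹' {r}) = G.neighborSet r := by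
    ext v
    constructor
    · rintro ⟨v, hv, rfl⟩
      have hadj := hp.adj v
      rw [show p v = r from hv] at hadj
      exact hadj.symm
    · intro hv
      have hdist := hp.dist_eq ⟨v, hv.ne'⟩
      rw [SimpleGraph.dist_eq_one_iff_adj.2 hv, right_eq_add, hG.dist_eq_zero_iff] at hdist
      exact ⟨⟨v, hv.ne'⟩, hdist.symm, rfl⟩
  rw [← Set.ncard_image_of_injective _ Subtype.val_injective, himage,
    Set.ncard_eq_toFinset_card', Set.toFinset_card, SimpleGraph.card_neighborSet_eq_degree]

end IsParentMap

end ParentMap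

section DegreeLeTwo

variable {V : Type*} {G : SimpleGraph V} {r : V}

theorem isPathGraph_of_dist_injective [Fintype V] (hG : G.Connected)
    (hinj : Function.Injective (G.dist r)) : IsPathGraph G := by
  have hlt (v : V) : G.dist r v < Fintype.card V := by
    obtain ⟨q, hq, hlen⟩ := hG.exists_path_of_dist r v
    exact hlen ▸ hq.length_lt
  let f (v : V) : Fin (Fintype.card V) := ⟨G.dist r v, hlt v⟩
  have hf : Function.Bijective f := by
    rw [Fintype.bijective_iff_injective_and_card]
    exact ⟨fun v w hvw => hinj (Fin.mk.inj hvw), (Fintype.card_fin _).symm⟩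
  have hadj {v w : V} (hvw : G.dist r v + 1 = G.dist r w) : G.Adj v w := by
    have hw : w ≠ r := by
      rintro rfl
      simp at hvw
    obtain ⟨u, hu, hdist⟩ := exists_adj_dist_eq_add_one hG hw
    obtain rfl : v = u := hinj (by omega)
    exact hu.symm
  refine ⟨Equiv.ofBijective f hf, fun {v w} => SimpleGraph.pathGraph_adj.trans ⟨?_, fun hvw => ?_⟩⟩
  · rintro (h | h)
    exacts [hadj h, (hadj h).symm]
  · have hne := hinj.ne hvw.ne
    change G.dist r v + 1 = G.dist r w ∨ G.dist r w + 1 = G.dist r v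
    rcases hvw.diff_dist_adj (u := r) with h | h | h <;> omega

theorem dist_injective_of_degree_le_two [G.LocallyFinite] (hG : G.Connected)
    (hr : G.degree r ≤ 1) (hdeg : ∀ v, G.degree v ≤ 2) : Function.Injective (G.dist r) := by
  classical
  suffices h : ∀ n v w, G.dist r v = n → G.dist r w = n → v = w from
    fun v w hvw => h _ v w hvw rfl
  intro n
  induction n with
  | zero =>
    intro v w hv hw
    exact (hG.dist_eq_zero_iff.1 hv).symm.trans (hG.dist_eq_zero_iff.1 hw)
  | succ n ih =>
    intro v w hv hw
    have hroot {u : V} (hu : G.dist r u = n + 1) : u ≠ r := by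
      rintro rfl
      simp at hu
    obtain ⟨u, hvu, hdv⟩ := exists_adj_dist_eq_add_one hG (hroot hv)
    obtain ⟨u', hwu, hdw⟩ := exists_adj_dist_eq_add_one hG (hroot hw)
    obtain rfl : u = u' := ih u u' (by omega) (by omega)
    by_cases hu : u = r
    · subst hu
      rw [← SimpleGraph.card_neighborFinset_eq_degree, Finset.card_le_one] at hr
      exact hr v (by simpa using hvu.symm) w (by simpa using hwu.symm)
    · by_contra hne
      obtain ⟨t, hut, hdu⟩ := exists_adj_dist_eq_add_one hG hu
      refine (hdeg u).not_gt ?_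
      rw [← SimpleGraph.card_neighborFinset_eq_degree, Finset.two_lt_card]
      refine ⟨v, by simpa using hvu.symm, w, by simpa using hwu.symm, t, by simpa using hut, hne,
        ?_, ?_⟩ <;> rintro rfl <;> omega

theorem exists_three_le_degree_of_not_isPathGraph [Fintype V] [DecidableRel G.Adj]
    (hG : G.IsTree) (hpath : ¬ IsPathGraph G) : ∃ v, 3 ≤ G.degree v := by
  by_contra! hdeg
  have hleaf : ∃ r, G.degree r ≤ 1 := by
    rcases subsingleton_or_nontrivial V with hV | hV
    · obtain ⟨r⟩ := hG.connected.nonempty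
      have hcard := Fintype.card_le_one_iff_subsingleton.2 hV
      exact ⟨r, (G.degree_lt_card_verts r).le.trans hcard⟩
    · exact hG.exists_vert_degree_one_of_nontrivial.imp fun _ => le_of_eq
  obtain ⟨r, hr⟩ := hleaf
  exact hpath <| isPathGraph_of_dist_injective hG.connected <|
    dist_injective_of_degree_le_two hG.connected hr fun v => Nat.lt_succ_iff.1 (hdeg v)

end DegreeLeTwo

section LowerBound

variable {V ι : Type*} {G : SimpleGraph V} {P : ι → GraphPath G}

/-- The vertex `v` is an end of the path `P`. -/
def GraphPath.IsEnd (P : GraphPath G) (v : V) : Prop := v = P.1 ∨ v = P.2.1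

theorem GraphPath.HasEdge.mem_edgeSet {P : GraphPath G} {e : Sym2 V} (he : P.HasEdge e) :
    e ∈ G.edgeSet :=
  P.2.2.1.edges_subset_edgeSet he

theorem GraphPath.isEnd_of_unique_edge {P : GraphPath G} {e : Sym2 V} {v : V}
    (he : P.HasEdge e) (hv : v ∈ e) (huniq : ∀ f, P.HasEdge f → v ∈ f → f = e) : P.IsEnd v := by
  obtain ⟨a, b, q, hq⟩ := P
  by_contra hend
  obtain ⟨hva, hvb⟩ := not_or.1 hend
  obtain ⟨i, rfl, hi⟩ := SimpleGraph.Walk.mem_support_iff_exists_getVert.1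
    (q.mem_support_of_mem_edges he hv)
  have hi0 : i ≠ 0 := by
    rintro rfl
    exact hva q.getVert_zero
  have hilen : i ≠ q.length := by
    rintro rfl
    exact hvb q.getVert_length
  obtain ⟨x, y, hxy, hnbr⟩ := Set.ncard_eq_two.1 <|
    hq.ncard_neighborSet_toSubgraph_internal_eq_two hi0 (lt_of_le_of_ne hi hilen)
  have hedge {z : V} (hz : z ∈ ({x, y} : Set V)) : s(q.getVert i, z) = e := by
    rw [← hnbr, SimpleGraph.Subgraph.mem_neighborSet, ← SimpleGraph.Subgraph.mem_edgeSet,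
      SimpleGraph.Walk.mem_edges_toSubgraph] at hz
    exact huniq _ hz (Sym2.mem_mk_left _ _)
  exact hxy (Sym2.congr_right.1 ((hedge (by simp)).trans (hedge (by simp)).symm))

/-- Of any two edges of `G`, each lies on a path of the family `P` that avoids the other. -/
def StronglySeparates (P : ι → GraphPath G) : Prop :=
  ∀ e ∈ G.edgeSet, ∀ f ∈ G.edgeSet, e ≠ f → ∃ i, (P i).HasEdge e ∧ ¬ (P i).HasEdge f

/-- An edge is light for the family `P` if exactly one member contains it. If `P` separates the
edges of `G`, that member has no other edge. -/
def IsLight (P : ι → GraphPath G) (e : Sym2 V) : Prop := ∃! i, (P i).HasEdge e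

/-- The members of the family `P` that contain a light edge. -/
def lightIndices (P : ι → GraphPath G) : Set ι := {i | ∃ e, IsLight P e ∧ (P i).HasEdge e}

namespace StronglySeparates

theorem eq_of_isLight (hP : StronglySeparates P) {i : ι} {e f : Sym2 V} (he : IsLight P e)
    (hie : (P i).HasEdge e) (hif : (P i).HasEdge f) : f = e := by
  by_contra hne
  obtain ⟨j, hje, hjf⟩ := hP e hie.mem_edgeSet f hif.mem_edgeSet (Ne.symm hne)
  exact hjf (he.unique hje hie ▸ hif)

theorem notMem_lightIndices (hP : StronglySeparates P) {i : ι} {e : Sym2 V} (he : ¬ IsLight P e)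
    (hie : (P i).HasEdge e) : i ∉ lightIndices P := by
  rintro ⟨f, hf, hif⟩
  exact he (hP.eq_of_isLight hf hif hie ▸ hf)

theorem exists_ne_hasEdge (hP : StronglySeparates P) (hG : G.edgeSet.Nontrivial) {e : Sym2 V}
    (he : e ∈ G.edgeSet) (hlight : ¬ IsLight P e) :
    ∃ i j, i ≠ j ∧ (P i).HasEdge e ∧ (P j).HasEdge e := by
  obtain ⟨f, hf, hfe⟩ := hG.exists_ne e
  obtain ⟨i, hi, -⟩ := hP e he f hf hfe.symm
  by_contra! h
  exact hlight ⟨i, hi, fun j hj => of_not_not fun hji => h i j (Ne.symm hji) hi hj⟩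

theorem exists_ne_isEnd (hP : StronglySeparates P) (hG : G.edgeSet.Nontrivial) {v : V}
    [Fintype (G.neighborSet v)] (hv : G.degree v ≤ 2) {e : Sym2 V} (he : e ∈ G.incidenceSet v)
    (hlight : ¬ IsLight P e) :
    ∃ i j, i ≠ j ∧ (i ∉ lightIndices P ∧ (P i).IsEnd v) ∧ j ∉ lightIndices P ∧ (P j).IsEnd v := by
  classical
  by_cases hheavy : ∃ f ∈ G.incidenceSet v, f ≠ e ∧ ¬ IsLight P f
  · obtain ⟨f, hf, hfe, hflight⟩ := hheavy
    have hincident {g : Sym2 V} (hg : g ∈ G.incidenceSet v) : g = e ∨ g = f := by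
      by_contra! hne
      rw [← SimpleGraph.card_incidenceFinset_eq_degree] at hv
      exact hv.not_gt <| Finset.two_lt_card.2 ⟨e, by simpa using he, f, by simpa using hf, g,
        by simpa using hg, hfe.symm, hne.1.symm, hne.2.symm⟩
    obtain ⟨i, hie, hif⟩ := hP e he.1 f hf.1 hfe.symm
    obtain ⟨j, hjf, hje⟩ := hP f hf.1 e he.1 hfe
    have hi : (P i).IsEnd v := GraphPath.isEnd_of_unique_edge hie he.2 fun g hg hvg =>
      (hincident ⟨hg.mem_edgeSet, hvg⟩).resolve_right fun h => hif (h ▸ hg)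
    have hj : (P j).IsEnd v := GraphPath.isEnd_of_unique_edge hjf hf.2 fun g hg hvg =>
      (hincident ⟨hg.mem_edgeSet, hvg⟩).resolve_left fun h => hje (h ▸ hg)
    exact ⟨i, j, fun hij => hif (hij ▸ hjf), ⟨hP.notMem_lightIndices hlight hie, hi⟩,
      hP.notMem_lightIndices hflight hjf, hj⟩
  · push Not at hheavy
    have hend {i : ι} (hi : (P i).HasEdge e) : (P i).IsEnd v := by
      refine GraphPath.isEnd_of_unique_edge hi he.2 fun g hg hvg => ?_
      by_contra hge
      exact hge (hP.eq_of_isLight (hheavy g ⟨hg.mem_edgeSet, hvg⟩ hge) hg hi).symm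
    obtain ⟨i, j, hij, hi, hj⟩ := hP.exists_ne_hasEdge hG he.1 hlight
    exact ⟨i, j, hij, ⟨hP.notMem_lightIndices hlight hi, hend hi⟩,
      hP.notMem_lightIndices hlight hj, hend hj⟩

theorem ncard_heavy_le [Finite ι] [Finite V] [G.LocallyFinite] (hP : StronglySeparates P)
    (hG : G.edgeSet.Nontrivial) :
    {v | G.degree v ≤ 2 ∧ ∃ e ∈ G.incidenceSet v, ¬ IsLight P e}.ncard ≤
      (lightIndices P)ᶜ.ncard := by
  classical
  have := Fintype.ofFinite ι
  have := Fintype.ofFinite V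
  rw [Set.ncard_eq_toFinset_card', Set.ncard_eq_toFinset_card']
  refine Nat.le_of_mul_le_mul_right ?_ two_pos
  refine Finset.card_mul_le_card_mul (fun v i => (P i).IsEnd v) (fun v hv => ?_) (fun i _ => ?_)
  · obtain ⟨hdeg, e, he, hlight⟩ := Set.mem_toFinset.1 hv
    obtain ⟨i, j, hij, hi, hj⟩ := hP.exists_ne_isEnd hG hdeg he hlight
    refine Finset.one_lt_card.2 ⟨i, ?_, j, ?_, hij⟩ <;> simpa [Finset.mem_bipartiteAbove]
  · refine (Finset.card_le_card fun v hv => ?_).trans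
      (Finset.card_le_two (a := (P i).1) (b := (P i).2.1))
    simpa [GraphPath.IsEnd] using (Finset.mem_bipartiteBelow _).1 hv |>.2

theorem ncard_all_light_le [Finite ι] {r : V} {p : {v // v ≠ r} → V} (hP : StronglySeparates P)
    (hp : IsParentMap G r p) :
    {v : {v // v ≠ r} | ∀ e ∈ G.incidenceSet (v : V), IsLight P e}.ncard ≤
      (lightIndices P).ncard := by
  have hlight (v : {v : {v // v ≠ r} | ∀ e ∈ G.incidenceSet (v : V), IsLight P e}) :
      IsLight P (parentEdge p v) :=
    v.2 _ ⟨hp.parentEdge_mem_edgeSet v, Sym2.mem_mk_left _ _⟩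
  choose i hi using fun v => (hlight v).exists
  refine Nat.card_le_card_of_injective (fun v => (⟨i v, _, hlight v, hi v⟩ : lightIndices P)) ?_
  intro v w hvw
  obtain hvw : i v = i w := congrArg Subtype.val hvw
  exact Subtype.ext <| hp.parentEdge_injective <|
    hP.eq_of_isLight (hlight w) (hi w) (hvw ▸ hi v)

theorem ncard_degree_le_two_le [Finite ι] [Finite V] [G.LocallyFinite] (hP : StronglySeparates P)
    {r : V} {p : {v // v ≠ r} → V} (hp : IsParentMap G r p) (hG : G.edgeSet.Nontrivial) :
    {v | v ≠ r ∧ G.degree v ≤ 2}.ncard ≤ Nat.card ι := by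
  have hcover : {v | v ≠ r ∧ G.degree v ≤ 2} ⊆
      {v | G.degree v ≤ 2 ∧ ∃ e ∈ G.incidenceSet v, ¬ IsLight P e} ∪
        (↑) '' {v : {v // v ≠ r} | ∀ e ∈ G.incidenceSet (v : V), IsLight P e} := by
    rintro v ⟨hv, hdeg⟩
    by_cases hheavy : ∃ e ∈ G.incidenceSet v, ¬ IsLight P e
    · exact .inl ⟨hdeg, hheavy⟩
    · push Not at hheavy
      exact .inr ⟨⟨v, hv⟩, hheavy, rfl⟩
  calc _ ≤ _ := Set.ncard_le_ncard hcover
    _ ≤ _ := Set.ncard_union_le _ _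
    _ ≤ (lightIndices P)ᶜ.ncard + (lightIndices P).ncard :=
      add_le_add (hP.ncard_heavy_le hG)
        ((Set.ncard_image_of_injective _ Subtype.val_injective).trans_le
          (hP.ncard_all_light_le hp))
    _ = Nat.card ι := by rw [add_comm, Set.ncard_add_ncard_compl]

end StronglySeparates

theorem IsRSPS.exists_stronglySeparates {k : ℕ} {P : Multiset (GraphPath G)} (hP : IsRSPS G k P) :
    ∃ Q : Fin P.card → GraphPath G, StronglySeparates Q := by
  obtain ⟨Q, rfl, hQ⟩ := hP
  refine ⟨fun i => (Q.map Prod.fst).toList.get (i.cast (Multiset.length_toList _).symm),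
    fun e he f hf hef => ?_⟩
  obtain ⟨x, hx, -, -, -, hxef, -⟩ := hQ e he f hf hef
  obtain ⟨i, hi⟩ := List.mem_iff_get.1 <|
    Multiset.mem_toList.2 <| Multiset.mem_map_of_mem Prod.fst hx
  refine ⟨i.cast (Multiset.length_toList _), ?_⟩
  simpa only [Fin.cast_cast, Fin.cast_eq_self, hi] using hxef

theorem card_le_rainbowSepNumber_add [Fintype V] (hG : G.Connected) {k : ℕ} (hk : 2 ≤ k) :
    Fintype.card V ≤ rainbowSepNumber G k + numBranchVertices G + 2 := by
  classical
  rcases Nat.lt_or_ge (Fintype.card V) 3 with hV | hV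
  · omega
  obtain ⟨P, hP, hcard⟩ := exists_isRSPS_card_eq G hk
  obtain ⟨Q, hQ⟩ := hP.exists_stronglySeparates
  obtain ⟨r⟩ := hG.nonempty
  obtain ⟨p, hp⟩ := exists_isParentMap hG r
  have hle := hQ.ncard_degree_le_two_le hp (hp.edgeSet_nontrivial hV)
  have hbranch : {v | 3 ≤ G.degree v}.ncard = numBranchVertices G := by
    rw [Set.ncard_eq_toFinset_card', Set.toFinset_ofPred, numBranchVertices]
  have hcover : Set.univ ⊆ {v | v ≠ r ∧ G.degree v ≤ 2} ∪ {v | 3 ≤ G.degree v} ∪ {r} := by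
    intro v _
    simp only [Set.mem_union, Set.mem_ofPred_eq, Set.mem_singleton_iff]
    by_cases hv : v = r <;> grind
  have hcardV := (Set.ncard_le_ncard hcover).trans (Set.ncard_union_le _ _)
  have hunion := Set.ncard_union_le {v | v ≠ r ∧ G.degree v ≤ 2} {v | 3 ≤ G.degree v}
  rw [Set.ncard_univ, Nat.card_eq_fintype_card, Set.ncard_singleton] at hcardV
  rw [Nat.card_fin, hcard] at hle
  omega

end LowerBound

section FiberRank

variable {α β : Type*} {f : α → β} {ρ : α → ℕ}

/-- `ρ` numbers the elements of every fiber of `f` consecutively, starting from `0`. -/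
def IsFiberRank (f : α → β) (ρ : α → ℕ) : Prop :=
  ∀ b, Set.BijOn ρ (f ⁻¹' {b}) (Set.Iio (f ⁻¹' {b}).ncard)

theorem exists_isFiberRank [Finite α] (f : α → β) : ∃ ρ, IsFiberRank f ρ := by
  have hfiber (b : β) : ∃ σ : α → ℕ, Set.BijOn σ (f ⁻¹' {b}) (Set.Iio (f ⁻¹' {b}).ncard) := by
    refine (Set.toFinite _).exists_bijOn_of_encard_eq ?_
    rw [← Finset.coe_Iio, Set.encard_coe_eq_coe_finsetCard, Nat.card_Iio,
      Set.Finite.cast_ncard_eq (Set.toFinite _)]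
  choose σ hσ using hfiber
  exact ⟨fun v => σ (f v) v, fun b => (hσ b).congr fun v hv => by rw [show f v = b from hv]⟩

namespace IsFiberRank

theorem lt_ncard (hρ : IsFiberRank f ρ) (v : α) : ρ v < (f ⁻¹' {f v}).ncard :=
  (hρ (f v)).mapsTo rfl

theorem eq_of_eq (hρ : IsFiberRank f ρ) {v w : α} (hf : f v = f w) (h : ρ v = ρ w) : v = w :=
  (hρ (f w)).injOn hf rfl h

theorem exists_eq (hρ : IsFiberRank f ρ) {b : β} {i : ℕ} (hi : i < (f ⁻¹' {b}).ncard) :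
    ∃ v, f v = b ∧ ρ v = i :=
  (hρ b).surjOn hi

end IsFiberRank

end FiberRank

section PredecessorMap

variable {V : Type*} {G : SimpleGraph V} {r : V} {p : {v // v ≠ r} → V}
  {φ : {v // v ≠ r} → {v // v ≠ r}}

/-- `φ` sends every vertex other than the root to its parent or to a sibling, and no two siblings
to the same vertex. Hence the edges above `u` and above the vertices of `φ ⁻¹' {u}` form a path. -/
structure IsPredecessorMap (p : {v // v ≠ r} → V) (φ : {v // v ≠ r} → {v // v ≠ r}) : Prop where
  parent_or_sibling (v : {v // v ≠ r}) : p v = φ v ∨ p v = p (φ v) ∧ v ≠ φ v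
  eq_of_eq {v w : {v // v ≠ r}} : φ v = φ w → p v = p w → v = w

theorem IsParentMap.exists_isPath_extension (hp : IsParentMap G r p) {x z : V} {q : G.Walk x z}
    (hq : q.IsPath) {A : Set {v // v ≠ r}} (hA : A.Subsingleton) (hparent : ∀ v ∈ A, p v = x)
    (hsupport : ∀ v ∈ A, ↑v ∉ q.support) :
    ∃ y, ∃ q' : G.Walk y z, q'.IsPath ∧
      (∀ v, v ∈ q'.support ↔ v ∈ ((↑) '' A : Set V) ∨ v ∈ q.support) ∧
      ∀ v, parentEdge p v ∈ q'.edges ↔ v ∈ A ∨ parentEdge p v ∈ q.edges := by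
  rcases hA.eq_empty_or_singleton with rfl | ⟨a, rfl⟩
  · exact ⟨x, q, hq, by simp, by simp⟩
  · obtain rfl := hparent a rfl
    refine ⟨a, .cons (hp.adj a) q, hq.cons (hsupport a rfl), by simp, fun v => ?_⟩
    rw [SimpleGraph.Walk.edges_cons, List.mem_cons, Set.mem_singleton_iff]
    exact or_congr_left (hp.parentEdge_injective.eq_iff (b := a))

namespace IsPredecessorMap

theorem ne (hφ : IsPredecessorMap p φ) (hp : IsParentMap G r p) (v : {v // v ≠ r}) : φ v ≠ v := by
  intro hv
  rcases hφ.parent_or_sibling v with h | ⟨-, h⟩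
  · exact (hp.adj v).ne' (h.trans (congrArg _ hv))
  · exact h hv.symm

theorem exists_path (hφ : IsPredecessorMap p φ) (hp : IsParentMap G r p) (u : {v // v ≠ r}) :
    ∃ Q : GraphPath G, ∀ v, Q.HasEdge (parentEdge p v) ↔ u ∈ ({v, φ v} : Set {v // v ≠ r}) := by
  have hsubsingleton (x : V) : {v | φ v = u ∧ p v = x}.Subsingleton := fun v hv w hw =>
    hφ.eq_of_eq (hv.1.trans hw.1.symm) (hv.2.trans hw.2.symm)
  obtain ⟨y, q, hq, hqsupport, hqedges⟩ := hp.exists_isPath_extension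
    (SimpleGraph.Path.singleton (hp.adj u)).2 (hsubsingleton u) (fun _ hv => hv.2) <| by
      rintro v ⟨-, hv⟩
      have hdu := hp.dist_eq u
      have hdv := hp.dist_eq v
      rw [hv] at hdv
      have hvu : (v : V) ≠ u := fun h => by rw [h] at hdv; omega
      have hvp : (v : V) ≠ p u := fun h => by rw [h] at hdv; omega
      simp [SimpleGraph.Path.singleton, hvu, hvp]
  obtain ⟨z, q', hq', -, hqedges'⟩ := hp.exists_isPath_extension hq.reverse (hsubsingleton (p u))
    (fun _ hv => hv.2) <| by
      rintro v ⟨hv, hpv⟩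
      have hvu : v ≠ u := fun h => hφ.ne hp u (h ▸ hv)
      have hvp : (v : V) ≠ p u := hpv ▸ (hp.adj v).ne
      have hpu : p v ≠ u := hpv ▸ hp.ne u
      simp [hqsupport, SimpleGraph.Path.singleton, hv, hvu, hvp, hpu, Subtype.coe_inj]
  refine ⟨⟨z, y, q', hq'⟩, fun v => ?_⟩
  have huv : parentEdge p v = s(↑u, p u) ↔ v = u := hp.parentEdge_injective.eq_iff (b := u)
  have hmem : φ v = u → p v = u ∨ p v = p u := by
    rintro rfl
    exact (hφ.parent_or_sibling v).imp_right And.left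
  simp only [GraphPath.HasEdge, hqedges', Set.mem_ofPred_eq, SimpleGraph.Walk.edges_reverse,
    List.mem_reverse, hqedges, SimpleGraph.Path.singleton, SimpleGraph.Walk.edges_cons,
    SimpleGraph.Walk.edges_nil, List.mem_cons, huv, List.not_mem_nil, or_false,
    Set.mem_insert_iff, Set.mem_singleton_iff]
  grind

end IsPredecessorMap

end PredecessorMap

section Precedes

variable {V : Type*} {G : SimpleGraph V} {r : V} {p : {v // v ≠ r} → V} {ρ : {v // v ≠ r} → ℕ}
  {u v w : {v // v ≠ r}}

/-- `i` follows `j` in the cyclic order of `0, …, D - 1`. -/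
def CycSucc (D i j : ℕ) : Prop := i < D ∧ (i = j + 1 ∨ (i = 0 ∧ j + 1 = D))

/-- With siblings ordered by `ρ`, the vertex `u` precedes its first child and its next sibling; the
children of the root are arranged in a cycle. -/
inductive Precedes (p : {v // v ≠ r} → V) (ρ : {v // v ≠ r} → ℕ) (u v : {v // v ≠ r}) : Prop
  | parent : p v = u → ρ v = 0 → Precedes p ρ u v
  | sibling : p v = p u → ρ v = ρ u + 1 → Precedes p ρ u v
  | wrap : p u = r → p v = r → ρ u + 1 = (p ⁻¹' {r}).ncard → ρ v = 0 → Precedes p ρ u v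

/-- The depth of `v`, and then its rank `ρ v`: the order in which the greedy colouring proceeds. -/
noncomputable def searchKey (G : SimpleGraph V) (ρ : {v // v ≠ r} → ℕ) (v : {v // v ≠ r}) :
    ℕ ×ₗ ℕ :=
  toLex (G.dist r v, ρ v)

theorem exists_precedes (hρ : IsFiberRank p ρ) (v : {v // v ≠ r}) : ∃ u, Precedes p ρ u v := by
  have hlt := hρ.lt_ncard v
  by_cases hv : ρ v = 0
  · by_cases hroot : p v = r
    · rw [hroot] at hlt
      obtain ⟨u, hu, hlast⟩ := hρ.exists_eq (Nat.sub_one_lt_of_lt hlt)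
      exact ⟨u, .wrap hu hroot (by omega) hv⟩
    · exact ⟨⟨p v, hroot⟩, .parent rfl hv⟩
  · obtain ⟨u, hu, hrank⟩ := hρ.exists_eq ((Nat.sub_le _ 1).trans_lt hlt)
    exact ⟨u, .sibling hu.symm (by omega)⟩

namespace Precedes

theorem parent_or_sibling (hD : 2 ≤ (p ⁻¹' {r}).ncard) (h : Precedes p ρ u v) :
    p v = u ∨ p v = p u ∧ v ≠ u := by
  rcases h with ⟨hpv, -⟩ | ⟨hpv, hrank⟩ | ⟨hpu, hpv, hlast, hfirst⟩
  · exact .inl hpv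
  · exact .inr ⟨hpv, fun huv => by subst huv; omega⟩
  · exact .inr ⟨hpv.trans hpu.symm, fun huv => by subst huv; omega⟩

theorem right_unique (hp : IsParentMap G r p) (hρ : IsFiberRank p ρ) (huv : Precedes p ρ u v)
    (huw : Precedes p ρ u w) (hvw : p v = p w) : v = w := by
  have hu := hp.ne u
  have hv := hρ.lt_ncard v
  have hw := hρ.lt_ncard w
  refine hρ.eq_of_eq hvw ?_
  -- A common child and sibling of `u` would make `u` its own parent, and a last child of the root
  -- has no next sibling.
  rcases huv with ⟨hpv, hv0⟩ | ⟨hpv, hvrank⟩ | ⟨-, hpv, hlast, hv0⟩ <;>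
    rcases huw with ⟨hpw, hw0⟩ | ⟨hpw, hwrank⟩ | ⟨hpu', hpw, hlast', hw0⟩ <;>
    grind

theorem isPredecessorMap (hp : IsParentMap G r p) (hρ : IsFiberRank p ρ)
    (hD : 2 ≤ (p ⁻¹' {r}).ncard) {φ : {v // v ≠ r} → {v // v ≠ r}}
    (hφ : ∀ v, Precedes p ρ (φ v) v) : IsPredecessorMap p φ where
  parent_or_sibling v := (hφ v).parent_or_sibling hD
  eq_of_eq {v w} hvw := right_unique hp hρ (hφ v) (hvw ▸ hφ w)

theorem searchKey_lt (hp : IsParentMap G r p) (h : Precedes p ρ u v) (hv : p v ≠ r) :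
    searchKey G ρ u < searchKey G ρ v := by
  have hdu := hp.dist_eq u
  have hdv := hp.dist_eq v
  rcases h with ⟨hpv, -⟩ | ⟨hpv, hrank⟩ | ⟨-, hpv, -, -⟩
  · rw [hpv] at hdv
    exact Prod.Lex.toLex_lt_toLex.2 (.inl (by dsimp only; omega))
  · rw [hpv] at hdv
    exact Prod.Lex.toLex_lt_toLex.2 (.inr ⟨by dsimp only; omega, by dsimp only; omega⟩)
  · exact absurd hpv hv

theorem parent_eq_root (h : Precedes p ρ u v) (hv : p v = r) : p u = r := by
  rcases h with ⟨hpv, -⟩ | ⟨hpv, -⟩ | ⟨hpu, -⟩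
  · exact absurd (hpv.symm.trans hv) u.2
  · exact hpv.symm.trans hv
  · exact hpu

theorem cycSucc (hρ : IsFiberRank p ρ) (h : Precedes p ρ u v) (hv : p v = r) :
    CycSucc (p ⁻¹' {r}).ncard (ρ v) (ρ u) := by
  have hlt := hρ.lt_ncard v
  rw [hv] at hlt
  refine ⟨hlt, ?_⟩
  rcases h with ⟨hpv, -⟩ | ⟨-, hrank⟩ | ⟨-, -, hlast, hfirst⟩
  · exact absurd (hpv.symm.trans hv) u.2
  · exact .inl hrank
  · exact .inr ⟨hfirst, hlast⟩

end Precedes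

end Precedes

section Coloring

theorem exists_greedy_coloring {α γ : Type*} [Fintype γ] {R : α → α → Prop} (hR : WellFounded R)
    (C : Set α) (κ₀ : α → γ) (B : α → Finset α) (hcard : ∀ v ∉ C, (B v).card < Fintype.card γ)
    (hlt : ∀ v ∉ C, ∀ w ∈ B v, R w v) :
    ∃ κ : α → γ, Set.EqOn κ κ₀ C ∧ ∀ v ∉ C, ∀ w ∈ B v, κ v ≠ κ w := by
  classical
  let F (v : α) (rec : ∀ w, R w v → γ) : γ :=
    if v ∈ C then κ₀ v
    else @Classical.epsilon γ ⟨κ₀ v⟩ fun c => ∀ w (hw : R w v), w ∈ B v → c ≠ rec w hw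
  refine ⟨hR.fix F, fun v hv => (hR.fix_eq F v).trans (if_pos hv), fun v hv w hw => ?_⟩
  obtain ⟨c, -, hc⟩ := Finset.exists_mem_notMem_of_card_lt_card <|
    (Finset.card_image_le (f := hR.fix F)).trans_lt (hcard v hv)
  rw [hR.fix_eq F v]
  simp only [F, if_neg hv]
  exact Classical.epsilon_spec (p := fun c => ∀ w, R w v → w ∈ B v → c ≠ hR.fix F w)
    ⟨c, fun w _ hw h => hc (h ▸ Finset.mem_image_of_mem _ hw)⟩ w (hlt v hv w hw) hw

/-- A colouring of a cycle of length `D ≥ 3` with four colours: the first `D % 3` positions get the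
colour `3` and the others the colours `0, 1, 2` in turn. Positions at distance two have different
colours, and so have adjacent ones, except for the positions `0` and `1` if `D % 3 = 2`. -/
def cycleColor (D i : ℕ) : ℕ := if i < D % 3 then 3 else (i - D % 3) % 3

theorem cycleColor_lt (D i : ℕ) : cycleColor D i < 4 := by
  unfold cycleColor
  split_ifs <;> omega

theorem cycleColor_ne {D i j l : ℕ} (hD : 3 ≤ D) (hij : CycSucc D i j) (hjl : CycSucc D j l) :
    cycleColor D i ≠ cycleColor D l := by
  unfold CycSucc at hij hjl
  unfold cycleColor
  split_ifs <;> omega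

theorem eq_one_of_cycleColor_eq {D i j : ℕ} (hD : 3 ≤ D) (hij : CycSucc D i j)
    (hc : cycleColor D i = cycleColor D j) : i = 1 := by
  unfold CycSucc at hij
  unfold cycleColor at hc
  split_ifs at hc <;> omega

/-- Consider the system of paths indexed by `α` in which the paths containing the edge `v : α` are
`v` and `φ v`. These conditions on a colouring `κ` of the paths make it rainbow separating. -/
structure IsSeparatingColoring {α γ : Type*} (φ : α → α) (κ : α → γ) : Prop where
  ne_iterate (v : α) : κ v ≠ κ (φ (φ v))
  ne_of_eq {v w : α} : v ≠ w → φ v = φ w → κ v ≠ κ w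
  eq_of_mono {v w : α} : κ v = κ (φ v) → κ w = κ (φ w) → v = w

theorem IsSeparatingColoring.exists_ne {α γ : Type*} {φ : α → α} {κ : α → γ}
    (hκ : IsSeparatingColoring φ κ) {v w : α} (hvw : v ≠ w) :
    ∃ x ∈ ({v, φ v} \ {w, φ w} : Set α), ∃ y ∈ ({w, φ w} \ {v, φ v} : Set α), κ x ≠ κ y := by
  have hne (u : α) : φ (φ u) ≠ u := fun h => hκ.ne_iterate u (congrArg κ h.symm)
  have hne' (u : α) : φ u ≠ u := fun h => hne u (by rw [h, h])
  by_cases hv : φ v = w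
  · subst hv
    exact ⟨v, by grind, φ (φ v), by grind, hκ.ne_iterate v⟩
  by_cases hw : φ w = v
  · subst hw
    exact ⟨φ (φ w), by grind, w, by grind, (hκ.ne_iterate w).symm⟩
  by_cases hφ : φ v = φ w
  · exact ⟨v, by grind, w, by grind, hκ.ne_of_eq hvw hφ⟩
  by_contra! hmono
  have h₁ := hmono v (by grind) w (by grind)
  have h₂ := hmono v (by grind) (φ w) (by grind)
  have h₃ := hmono (φ v) (by grind) w (by grind)
  exact hvw (hκ.eq_of_mono (h₁.trans h₃.symm) (h₁.symm.trans h₂))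

variable {V : Type*} {G : SimpleGraph V} {r : V} {p : {v // v ≠ r} → V}
  {φ : {v // v ≠ r} → {v // v ≠ r}} {ρ : {v // v ≠ r} → ℕ}

open Classical in
/-- The vertices whose colours the greedy colouring must avoid at `v`: the two preceding vertices
and, if `φ v` is the parent of `v`, the sibling of `φ v` that `φ` sends to `φ v` as well. -/
noncomputable def forbidden [Fintype V] (p : {v // v ≠ r} → V) (φ : {v // v ≠ r} → {v // v ≠ r})
    (v : {v // v ≠ r}) : Finset {v // v ≠ r} :=
  {φ v, φ (φ v)} ∪ Finset.univ.filter fun w => φ w = φ v ∧ p w = p (φ v) ∧ p v = φ v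

theorem card_forbidden_le [Fintype V] (hφ : IsPredecessorMap p φ) (v : {v // v ≠ r}) :
    (forbidden p φ v).card ≤ 3 := by
  classical
  refine (Finset.card_union_le _ _).trans (add_le_add Finset.card_le_two (Finset.card_le_one.2 ?_))
  simp only [Finset.mem_filter, Finset.mem_univ, true_and]
  rintro w ⟨hw, hpw, -⟩ w' ⟨hw', hpw', -⟩
  exact hφ.eq_of_eq (hw.trans hw'.symm) (hpw.trans hpw'.symm)

theorem searchKey_lt_of_mem_forbidden [Fintype V] (hp : IsParentMap G r p)
    (hφ : ∀ v, Precedes p ρ (φ v) v) {v w : {v // v ≠ r}} (hv : p v ≠ r)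
    (hw : w ∈ forbidden p φ v) : searchKey G ρ w < searchKey G ρ v := by
  have hlt := (hφ v).searchKey_lt hp hv
  simp only [forbidden, Finset.mem_union, Finset.mem_insert, Finset.mem_singleton,
    Finset.mem_filter, Finset.mem_univ, true_and] at hw
  rcases hw with (rfl | rfl) | ⟨-, hpw, hpv⟩
  · exact hlt
  · by_cases hroot : p (φ v) = r
    · have hone := hp.dist_eq_one ((hφ (φ v)).parent_eq_root hroot)
      have hdist := hp.dist_eq v
      have hparent := hp.dist_eq ⟨p v, hv⟩
      exact Prod.Lex.toLex_lt_toLex.2 (.inl (by dsimp only at hparent ⊢; omega))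
    · exact ((hφ (φ v)).searchKey_lt hp hroot).trans hlt
  · have hdist := hp.dist_eq v
    rw [hpv, hp.dist_eq (φ v), ← hpw, ← hp.dist_eq w] at hdist
    exact Prod.Lex.toLex_lt_toLex.2 (.inl (by dsimp only; omega))

theorem exists_isSeparatingColoring [Finite V] (hp : IsParentMap G r p) (hρ : IsFiberRank p ρ)
    (hD : 3 ≤ (p ⁻¹' {r}).ncard) (hφ : ∀ v, Precedes p ρ (φ v) v) {k : ℕ} (hk : 4 ≤ k) :
    ∃ κ : {v // v ≠ r} → Fin k, IsSeparatingColoring φ κ := by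
  have := Fintype.ofFinite V
  have hpred := Precedes.isPredecessorMap hp hρ (by omega) hφ
  obtain ⟨κ, hroot, hforbidden⟩ := exists_greedy_coloring
    (InvImage.wf (searchKey G ρ) wellFounded_lt) (p ⁻¹' {r})
    (fun v => (⟨cycleColor (p ⁻¹' {r}).ncard (ρ v), (cycleColor_lt _ _).trans_le hk⟩ : Fin k))
    (forbidden p φ)
    (fun v _ => (card_forbidden_le hpred v).trans_lt (hk.trans_eq (Fintype.card_fin k).symm))
    (fun v hv w => searchKey_lt_of_mem_forbidden hp hφ hv)
  have hne {v w : {v // v ≠ r}} (hvw : φ v = φ w) (hv : p v = φ v) (hw : p w = p (φ w)) :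
      κ v ≠ κ w := by
    refine hforbidden v (fun h => (φ v).2 (hv.symm.trans h)) w ?_
    simp [forbidden, hvw, hw, hv]
  have hmono {v : {v // v ≠ r}} (hv : κ v = κ (φ v)) : p v = r ∧ ρ v = 1 := by
    have hpv : p v = r := by
      by_contra hpv
      exact hforbidden v hpv (φ v) (by simp [forbidden]) hv
    rw [hroot hpv, hroot ((hφ v).parent_eq_root hpv)] at hv
    exact ⟨hpv, eq_one_of_cycleColor_eq hD ((hφ v).cycSucc hρ hpv) (Fin.mk.inj hv)⟩
  refine ⟨κ, fun v => ?_, fun {v w} hvw h => ?_, fun {v w} hv hw => ?_⟩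
  · by_cases hpv : p v = r
    · have hpv' := (hφ v).parent_eq_root hpv
      rw [hroot hpv, hroot ((hφ (φ v)).parent_eq_root hpv')]
      exact fun hc => cycleColor_ne hD ((hφ v).cycSucc hρ hpv) ((hφ (φ v)).cycSucc hρ hpv')
        (Fin.mk.inj hc)
    · exact hforbidden v hpv _ (by simp [forbidden])
  · rcases hpred.parent_or_sibling v with hv | ⟨hv, -⟩ <;>
      rcases hpred.parent_or_sibling w with hw | ⟨hw, -⟩
    · exact absurd (hpred.eq_of_eq h (by rw [hv, hw, h])) hvw
    · exact hne h hv hw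
    · exact (hne h.symm hw hv).symm
    · exact absurd (hpred.eq_of_eq h (by rw [hv, hw, h])) hvw
  · exact hρ.eq_of_eq ((hmono hv).1.trans (hmono hw).1.symm) ((hmono hv).2.trans (hmono hw).2.symm)

end Coloring

section UpperBound

variable {V ι : Type*} {G : SimpleGraph V} {k : ℕ}

theorem rainbowSepNumber_le_card [Fintype ι] (Q : ι → GraphPath G) (κ : ι → Fin k)
    (h : ∀ e ∈ G.edgeSet, ∀ f ∈ G.edgeSet, e ≠ f → ∃ i j, κ i ≠ κ j ∧
      ((Q i).HasEdge e ∧ ¬ (Q i).HasEdge f) ∧ ((Q j).HasEdge f ∧ ¬ (Q j).HasEdge e)) :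
    rainbowSepNumber G k ≤ Fintype.card ι := by
  let M : Multiset (GraphPath G × Fin k) := Finset.univ.val.map fun i => (Q i, κ i)
  have hM (i : ι) : (Q i, κ i) ∈ M := Multiset.mem_map_of_mem _ (Finset.mem_univ i)
  refine Nat.sInf_le ⟨M.map Prod.fst, ⟨M, rfl, fun e he f hf hef => ?_⟩, by simp [M]⟩
  obtain ⟨i, j, hij⟩ := h e he f hf hef
  exact ⟨_, hM i, _, hM j, hij⟩

theorem rainbowSepNumber_le_of_three_le_degree [Fintype V] (hG : G.IsTree) {r : V}
    [Fintype (G.neighborSet r)] (hr : 3 ≤ G.degree r) (hk : 4 ≤ k) :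
    rainbowSepNumber G k ≤ Fintype.card V - 1 := by
  classical
  obtain ⟨p, hp⟩ := exists_isParentMap hG.connected r
  obtain ⟨ρ, hρ⟩ := exists_isFiberRank p
  choose φ hφ using exists_precedes hρ
  have hD : 3 ≤ (p ⁻¹' {r}).ncard := (hp.ncard_children_root hG.connected).symm ▸ hr
  obtain ⟨κ, hκ⟩ := exists_isSeparatingColoring hp hρ hD hφ hk
  choose Q hQ using (Precedes.isPredecessorMap hp hρ (by omega) hφ).exists_path hp
  have hle : rainbowSepNumber G k ≤ Fintype.card {v // v ≠ r} := by
    refine rainbowSepNumber_le_card Q κ ?_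
    rw [← hp.range_parentEdge hG]
    rintro - ⟨v, rfl⟩ - ⟨w, rfl⟩ hvw
    obtain ⟨x, ⟨hxv, hxw⟩, y, ⟨hyw, hyv⟩, hxy⟩ := hκ.exists_ne (ne_of_apply_ne _ hvw)
    exact ⟨x, y, hxy, ⟨(hQ x v).2 hxv, mt (hQ x w).1 hxw⟩, (hQ y w).2 hyw, mt (hQ y v).1 hyv⟩
  rwa [Fintype.card_subtype_compl, Fintype.card_subtype_eq] at hle

end UpperBound

end RainbowSep

open RainbowSep Filter Asymptotics in
theorem mainTheorem4_general :
    (∀ (V : Type*) [Fintype V] (T : SimpleGraph V), T.IsTree → ¬ IsPathGraph T →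
      ∀ k : ℕ, 4 ≤ k → rainbowSepNumber T k ≤ Fintype.card V - 1) ∧
    (∀ (ι : Type*) (V : ι → Type*) [∀ i, Fintype (V i)] (G : ∀ i, SimpleGraph (V i)),
      (∀ i, (G i).Connected) →
      ∀ b : ℕ → ℝ, b =o[atTop] (fun n : ℕ => (n : ℝ)) →
      (∀ i, (numBranchVertices (G i) : ℝ) ≤ b (Fintype.card (V i))) →
      ∃ g : ℕ → ℝ, g =o[atTop] (fun n : ℕ => (n : ℝ)) ∧
        ∀ k : ℕ, 2 ≤ k → ∀ i,
          ((Fintype.card (V i) : ℝ) - 1) - g (Fintype.card (V i)) ≤ rainbowSepNumber (G i) k) := by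
  refine ⟨fun V _ T hT hpath k hk => ?_, fun ι V _ G hG b hb hbG => ?_⟩
  · classical
    obtain ⟨r, hr⟩ := exists_three_le_degree_of_not_isPathGraph hT hpath
    exact rainbowSepNumber_le_of_three_le_degree hT hr hk
  · refine ⟨fun n => b n + 1, hb.add ?_, fun k hk i => ?_⟩
    · exact isLittleO_const_left.2 <| .inr <|
        tendsto_norm_atTop_atTop.comp tendsto_natCast_atTop_atTop
    · have hle : (Fintype.card (V i) : ℝ) ≤
          rainbowSepNumber (G i) k + numBranchVertices (G i) + 2 :=
        mod_cast card_le_rainbowSepNumber_add (hG i) hk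
      linarith [hbG i]

open RainbowSep Filter Asymptotics in
theorem mainTheorem4 :
    (∀ (V : Type*) [Fintype V] (T : SimpleGraph V), T.IsTree → ¬ IsPathGraph T →
      ∀ k : ℕ, 4 ≤ k → rainbowSepNumber T k ≤ Fintype.card V - 1) ∧
    (∀ (ι : Type*) (V : ι → Type*) [∀ i, Fintype (V i)] (T : ∀ i, SimpleGraph (V i)),
      IsPathyTreeClass T →
      ∃ g : ℕ → ℝ, g =o[atTop] (fun n : ℕ => (n : ℝ)) ∧
        ∀ k : ℕ, 4 ≤ k → ∀ i,
          ((Fintype.card (V i) : ℝ) - 1) - g (Fintype.card (V i)) ≤ (rainbowSepNumber (T i) k : ℝ)) := by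
  obtain ⟨hupper, hlower⟩ := mainTheorem4_general
  refine ⟨hupper, fun ι V _ T ⟨htree, b, hb, hbT⟩ => ?_⟩
  exact (hlower ι V T (fun i => (htree i).connected) b hb hbT).imp fun g hg =>
    ⟨hg.1, fun k hk => hg.2 k (by omega)⟩
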